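/- Let $n,r\ge 1$. Consider four disjoint alphabets $\{x^1_1,\dots,x^1_n\}$, $\{x^2_1,\dots,x^2_n\}$, $\{y^1_1,\dots,y^1_r\}$, $\{y^2_1,\dots,y^2_r\}$, and regard $x^i_my^i_l$ $(1\le m\le n,\ 1\le l\le r)$ as the edges of a complete bipartite graph $G_i$, for $i=1,2$. Let $\beta$ be a bijection from the edges of $G_1$ to the edges of $G_2$ that sends every edge at $x^1_m$ to an edge at $x^2_m$, and let $\mathcal P$ be the square polygonal presentation consisting of the $nr$ cyclic words $(x^1_m,y^1_l,x^2_m,y^2_j)$ with $\beta(x^1_my^1_l)=x^2_my^2_j$. Let $X$ be the corresponding polyhedron: take one oriented square for each of these words, write the word along its boundary, and identify all sides with the same label, preserving orientation. Suppose that $\mathcal P$ satisfies the stable pairs condition: for all $m,l,j$, the word $(x^1_m,y^1_l,x^2_m,y^2_j)$ belongs to $\mathcal P$ if and only if every word of $\mathcal P$ that contains $x^1_m$ or $x^2_m$ has the form $(x^1_m,y^1_s,x^2_m,y^2_t)$ for some $s,t$, and every word of $\mathcal P$ that contains $y^1_l$ or $y^2_j$ has the form $(x^1_p,y^1_l,x^2_p,y^2_j)$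 for some $p$. Then, for every base point, the fundamental group of $X$ is of Burger–Mozes type, acting on a product of trees of valences $2(n-1)$ and $2(r-1)$. That is, there are trees $\mathcal T_1$ and $\mathcal T_2$ in which every vertex has valence $2(n-1)$ and $2(r-1)$, respectively (a tree of valence $0$ is a single vertex), such that $\pi_1(X)$ is isomorphic to a discrete torsion-free subgroup of $\mathrm{Aut}(\mathcal T_1)\times\mathrm{Aut}(\mathcal T_2)$ (with the topology of pointwise convergence on vertices) that acts freely and transitively on the set of vertices of $\mathcal T_1\times\mathcal T_2$. -/

import Mathlib

namespace BMType

/-! ### Groups of Burger--Mozes type -/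

/-- The automorphism group of a graph carries the topology of pointwise convergence on the
(discrete) vertex set. -/
instance autTopology {V : Type*} (T : SimpleGraph V) : TopologicalSpace (T ≃g T) :=
  TopologicalSpace.induced (fun (g : T ≃g T) (v : V) => g v)
    (@Pi.topologicalSpace V (fun _ => V) (fun _ => ⊥))

/-- Every vertex of `T` has exactly `d` neighbours. -/
def HasValence {V : Type*} (T : SimpleGraph V) (d : ℕ) : Prop :=
  ∀ v : V, (T.neighborSet v).encard = (d : ℕ∞)

/-- A subgroup of `Aut T₁ × Aut T₂` is a *Burger--Mozes group* if it is discrete, torsion free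
and acts freely and transitively on the vertices of the product `T₁ × T₂`. -/
structure IsBMSubgroup {V₁ V₂ : Type*} {T₁ : SimpleGraph V₁} {T₂ : SimpleGraph V₂}
    (Γ : Subgroup ((T₁ ≃g T₁) × (T₂ ≃g T₂))) : Prop where
  discrete : DiscreteTopology Γ
  torsionFree : ∀ g : Γ, g ≠ 1 → ¬ IsOfFinOrder g
  free : ∀ g ∈ Γ, ∀ (v₁ : V₁) (v₂ : V₂), g.1 v₁ = v₁ → g.2 v₂ = v₂ → g = 1
  transitive : ∀ (v₁ w₁ : V₁) (v₂ w₂ : V₂), ∃ g ∈ Γ, g.1 v₁ = w₁ ∧ g.2 v₂ = w₂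

/-- `G` is a group of Burger--Mozes type, acting on a product of two trees of valences
`d₁` and `d₂`. (Such trees are countable, so that vertex sets in `Type` suffice.) -/
def IsOfBMType (d₁ d₂ : ℕ) (G : Type*) [Group G] : Prop :=
  ∃ (V₁ V₂ : Type) (T₁ : SimpleGraph V₁) (T₂ : SimpleGraph V₂)
    (Γ : Subgroup ((T₁ ≃g T₁) × (T₂ ≃g T₂))),
    T₁.IsTree ∧ T₂.IsTree ∧ HasValence T₁ d₁ ∧ HasValence T₂ d₂ ∧
      IsBMSubgroup Γ ∧ Nonempty (G ≃* Γ)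

/-! ### Polyhedra with oriented square faces -/

/-- The four sides of the unit square, each parametrized in the direction in which the boundary
is traversed once, starting from the corner `(0, 0)`. -/
def side : Fin 4 → unitInterval → unitInterval × unitInterval :=
  ![fun t => (t, 0), fun t => (1, t), fun t => (unitInterval.symm t, 1),
    fun t => (0, unitInterval.symm t)]

/-- For a family `w` of words of length four, the square `f` has the word `w f` written on its
boundary. Sides that carry the same letter are identified, preserving orientation. -/
inductive SideRel {F A : Type*} (w : F → Fin 4 → A) :
    (Σ _ : F, unitInterval × unitInterval) → (Σ _ : F, unitInterval × unitInterval) → Prop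
  | glue (f g : F) (i j : Fin 4) (h : w f i = w g j) (t : unitInterval) :
      SideRel w ⟨f, side i t⟩ ⟨g, side j t⟩

/-- The polyhedron obtained from one oriented square for each member of the family `w` of words
by identifying the sides with equal labels. -/
def Polyhedron {F A : Type*} (w : F → Fin 4 → A) : Type _ := Quot (SideRel w)

instance {F A : Type*} (w : F → Fin 4 → A) : TopologicalSpace (Polyhedron w) :=
  inferInstanceAs (TopologicalSpace (Quot (SideRel w)))

/-! ### The square polygonal presentations -/

/-- The alphabet: the letters `x¹_m`, `x²_m` with `n` values of `m`, and the letters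
`y¹_l`, `y²_l` with `r` values of `l`. -/
inductive Letter (n r : ℕ) : Type
  | x₁ (m : Fin n)
  | x₂ (m : Fin n)
  | y₁ (l : Fin r)
  | y₂ (l : Fin r)

/-- The word `(x¹_m, y¹_l, x²_p, y²_j)`. -/
def word {n r : ℕ} (m : Fin n) (l : Fin r) (p : Fin n) (j : Fin r) : Fin 4 → Letter n r :=
  ![Letter.x₁ m, Letter.y₁ l, Letter.x₂ p, Letter.y₂ j]

/-- The edge `x¹_m y¹_l` of the complete bipartite graph `G₁` is the pair `(m, l)`, the edge
`x²_m y²_j` of the complete bipartite graph `G₂` is the pair `(m, j)`. A bijection `β` from the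
edges of `G₁` to those of `G₂` gives one cyclic word `(x¹_m, y¹_l, x²_p, y²_j)` for each edge
`(m, l)` of `G₁`, where `β (m, l) = (p, j)`. (Different edges give words that are not
cyclic rotations of each other.) -/
def presentation {n r : ℕ} (β : Fin n × Fin r ≃ Fin n × Fin r) :
    Fin n × Fin r → Fin 4 → Letter n r :=
  fun e => word e.1 e.2 (β e).1 (β e).2

/-- The letter `a` occurs in the word `u`. -/
def Contains {n r : ℕ} (u : Fin 4 → Letter n r) (a : Letter n r) : Prop := ∃ i, u i = a

/-- The stable pairs condition for a set of words: a word `(x¹_m, y¹_l, x²_m, y²_j)` belongs to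
the set if and only if every word of the set that contains `x¹_m` or `x²_m` has the form
`(x¹_m, y¹_s, x²_m, y²_t)` and every word of the set that contains `y¹_l` or `y²_j` has the form
`(x¹_p, y¹_l, x²_p, y²_j)`. -/
def StablePairs {n r : ℕ} (P : Set (Fin 4 → Letter n r)) : Prop :=
  ∀ (m : Fin n) (l j : Fin r), word m l m j ∈ P ↔
    (∀ u ∈ P, Contains u (Letter.x₁ m) ∨ Contains u (Letter.x₂ m) →
      ∃ s t : Fin r, u = word m s m t) ∧
    (∀ u ∈ P, Contains u (Letter.y₁ l) ∨ Contains u (Letter.y₂ j) →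
      ∃ p : Fin n, u = word p l p j)

end BMType

/-! Applied to a word of the presentation, the stable pairs condition says that its letters $y^1_l$
and $y^2_j$ occur only together (`StablePairs.snd_eq_iff`). The letters $x^1_m$, $x^2_m$ are paired
by the hypothesis on $\beta$. Hence two squares $(m,l)$ and $(m',l')$ share their $x$-sides iff
$m=m'$ and their $y$-sides iff $l=l'$, and $X$ is the product $\Theta_n\times\Theta_r$ of graphs
with two vertices joined by $n$, respectively $r$, edges (`nonempty_homeomorph_polyhedron`).

A theta graph with $k+1$ edges is the quotient of a contractible tree by a free action of the free
group $F_k$ (`isQuotientCoveringMap_thetaCover`); the product of two such coverings gives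
$\pi_1(X)\cong F_{n-1}\times F_{r-1}$. This group acts simply transitively on the vertices of the
product of the Cayley trees of its factors, of valences $2(n-1)$ and $2(r-1)$
(`isOfBMType_of_mulEquiv`). -/

namespace SimpleGraph

/-- A graph with a rank function that takes different values at adjacent vertices, and in which no
vertex has two neighbours of smaller rank, has no cycles. -/
theorem isAcyclic_of_rank {V : Type*} {T : SimpleGraph V} (rank : V → ℕ)
    (hne : ∀ u v, T.Adj u v → rank u ≠ rank v)
    (huniq : ∀ v u u', T.Adj v u → T.Adj v u' → rank u < rank v → rank u' < rank v → u = u') :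
    T.IsAcyclic := by
  classical
  intro v c hc
  -- At a vertex of maximal rank on the cycle, both cycle neighbours have smaller rank, and they are
  -- distinct.
  obtain ⟨u, hu, hmax⟩ := c.support.toFinset.exists_max_image rank ⟨v, by simp⟩
  simp only [List.mem_toFinset] at hu hmax
  have hc' := hc.rotate hu
  have hlt : ∀ w ∈ (c.rotate u hu).support, T.Adj u w → rank w < rank u := fun w hw hadj =>
    lt_of_le_of_ne (hmax w ((c.mem_support_rotate_iff u hu).1 hw)) (hne u w hadj).symm
  have h₁ := (c.rotate u hu).adj_snd hc'.not_nil
  have h₂ := ((c.rotate u hu).adj_penultimate hc'.not_nil).symm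
  exact hc'.snd_ne_penultimate (huniq u _ _ h₁ h₂
    (hlt _ (Walk.getVert_mem_support ..) h₁) (hlt _ (Walk.getVert_mem_support ..) h₂))

end SimpleGraph

/-! ### Cayley trees of free groups. -/

namespace FreeGroup

variable {α : Type*}

theorem mk_singleton_not_mul_cancel (w : α × Bool) (g : FreeGroup α) :
    mk [(w.1, !w.2)] * (mk [w] * g) = g := by
  rw [← mul_assoc, show mk [(w.1, !w.2)] = (mk [w])⁻¹ by simp [inv_mk, invRev],
    inv_mul_cancel, one_mul]

variable [DecidableEq α]

theorem toWord_mk_singleton_mul (w : α × Bool) (g : FreeGroup α) :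
    (mk [w] * g).toWord =
      if g.toWord.head? = some (w.1, !w.2) then g.toWord.tail else w :: g.toWord := by
  rw [toWord_mul, toWord_mk, reduce_singleton, List.singleton_append, reduce.cons, reduce_toWord]
  rcases g.toWord with _ | ⟨⟨i, b⟩, L⟩
  · simp
  · obtain ⟨j, c⟩ := w
    by_cases h : j = i <;> cases b <;> cases c <;> simp [h, Ne.symm]

theorem norm_mk_singleton_mul_of_head {w : α × Bool} {g : FreeGroup α}
    (h : g.toWord.head? = some (w.1, !w.2)) : (mk [w] * g).norm + 1 = g.norm := by
  rw [norm, norm, toWord_mk_singleton_mul, if_pos h]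
  rcases hg : g.toWord with _ | ⟨a, L⟩
  · simp [hg] at h
  · simp

theorem norm_mk_singleton_mul_of_not_head {w : α × Bool} {g : FreeGroup α}
    (h : g.toWord.head? ≠ some (w.1, !w.2)) : (mk [w] * g).norm = g.norm + 1 := by
  rw [norm, norm, toWord_mk_singleton_mul, if_neg h, List.length_cons]

/-- Only the inverse of the first letter shortens a reduced word, so a vertex of the Cayley graph
has at most one neighbour of smaller norm. -/
theorem head_of_norm_mk_singleton_mul_lt {w : α × Bool} {g : FreeGroup α}
    (h : (mk [w] * g).norm < g.norm) : g.toWord.head? = some (w.1, !w.2) := by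
  by_contra h'
  have := norm_mk_singleton_mul_of_not_head h'
  omega

theorem mk_singleton_injective : Function.Injective fun w : α × Bool => mk [w] := by
  intro w w' h
  simpa [reduce_singleton] using congrArg toWord h

omit [DecidableEq α] in
theorem mk_cons (w : α × Bool) (L : List (α × Bool)) : mk (w :: L) = mk [w] * mk L := by
  rw [mul_mk, List.singleton_append]

/-- The Cayley graph of a free group, in which the neighbours of an element are its products with
the letters from the left. -/
def cayleyGraph (α : Type*) : SimpleGraph (FreeGroup α) where
  Adj g h := ∃ w : α × Bool, h = mk [w] * g
  symm := ⟨by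
    rintro g _ ⟨w, rfl⟩
    exact ⟨_, (mk_singleton_not_mul_cancel w g).symm⟩⟩
  loopless := ⟨by
    classical
    rintro g ⟨w, h⟩
    have h1 : mk [w] = 1 := by simpa using h
    have := congrArg toWord h1
    simp at this⟩

omit [DecidableEq α] in
theorem cayleyGraph_isTree (α : Type*) : (cayleyGraph α).IsTree := by
  classical
  refine ⟨⟨fun g h => ?_⟩, SimpleGraph.isAcyclic_of_rank norm ?_ ?_⟩
  · have key : ∀ L : List (α × Bool), (cayleyGraph α).Reachable 1 (mk L) := by
      intro L
      induction L with
      | nil => rfl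
      | cons w L ih =>
        exact ih.trans (SimpleGraph.Adj.reachable ⟨w, mk_cons w L⟩)
    have key' : ∀ g, (cayleyGraph α).Reachable 1 g := fun g => by
      simpa [mk_toWord] using key g.toWord
    exact (key' g).symm.trans (key' h)
  · rintro g _ ⟨w, rfl⟩
    by_cases h : g.toWord.head? = some (w.1, !w.2)
    · have := norm_mk_singleton_mul_of_head h
      omega
    · have := norm_mk_singleton_mul_of_not_head h
      omega
  · rintro g _ _ ⟨w, rfl⟩ ⟨w', rfl⟩ h h'
    have := (head_of_norm_mk_singleton_mul_lt h).symm.trans (head_of_norm_mk_singleton_mul_lt h')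
    have : w = w' := by
      simp only [Option.some.injEq, Prod.mk.injEq, Bool.not_inj_iff] at this
      exact Prod.ext this.1 this.2
    rw [this]

theorem cayleyGraph_hasValence (k : ℕ) :
    BMType.HasValence (cayleyGraph (Fin k)) (2 * k) := by
  intro g
  have : (cayleyGraph (Fin k)).neighborSet g = Set.range fun w : Fin k × Bool => mk [w] * g := by
    ext h
    simp [SimpleGraph.neighborSet, cayleyGraph, eq_comm]
  rw [this, ← Set.image_univ, Function.Injective.encard_image
    (fun w w' h => mk_singleton_injective (mul_right_cancel h)), Set.encard_univ,
    ENat.card_eq_coe_fintype_card]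
  simp [mul_comm]

/-- A free group acts on its Cayley graph by right multiplication. -/
def cayleyAut (α : Type*) : FreeGroup α →* (cayleyGraph α ≃g cayleyGraph α) where
  toFun g :=
    { toEquiv := Equiv.mulRight g⁻¹
      map_rel_iff' := by
        intro a b
        simp [cayleyGraph, ← mul_assoc] }
  map_one' := by
    ext x
    simp
  map_mul' g h := by
    ext x
    simp [mul_assoc]

end FreeGroup

/-! ### Products of two free groups are of Burger–Mozes type. -/

namespace BMType

theorem isOpen_setOf_apply_eq {V : Type*} (T : SimpleGraph V) (v w : V) :
    IsOpen {g : T ≃g T | g v = w} := by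
  let _ : TopologicalSpace V := ⊥
  have : DiscreteTopology V := ⟨rfl⟩
  have h : Continuous fun g : T ≃g T => (g : V → V) := continuous_induced_dom
  exact (isOpen_discrete {w}).preimage ((continuous_apply v).comp h)

/-- Right translation is simply transitive on each factor. Torsion-freeness is inherited from the
free groups. -/
theorem isOfBMType_of_mulEquiv {G : Type*} [Group G] {a b : ℕ}
    (e : G ≃* FreeGroup (Fin a) × FreeGroup (Fin b)) : IsOfBMType (2 * a) (2 * b) G := by
  let φ := (FreeGroup.cayleyAut (Fin a)).prodMap (FreeGroup.cayleyAut (Fin b))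
  have hφ : ∀ g v₁ v₂, (φ g).1 v₁ = v₁ → (φ g).2 v₂ = v₂ → g = 1 := by
    rintro ⟨g₁, g₂⟩ v₁ v₂ h₁ h₂
    have h₁ : v₁ * g₁⁻¹ = v₁ := h₁
    have h₂ : v₂ * g₂⁻¹ = v₂ := h₂
    simp_all
  have hinj : Function.Injective φ := (injective_iff_map_eq_one φ).2 fun g hg =>
    hφ g 1 1 (by rw [hg]; rfl) (by rw [hg]; rfl)
  refine ⟨_, _, FreeGroup.cayleyGraph (Fin a), FreeGroup.cayleyGraph (Fin b), φ.range,
    FreeGroup.cayleyGraph_isTree _, FreeGroup.cayleyGraph_isTree _,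
    FreeGroup.cayleyGraph_hasValence a, FreeGroup.cayleyGraph_hasValence b, ?_,
    ⟨e.trans (MonoidHom.ofInjective hinj)⟩⟩
  have hfree : ∀ g ∈ φ.range, ∀ v₁ v₂, g.1 v₁ = v₁ → g.2 v₂ = v₂ → g = 1 := by
    rintro _ ⟨g, rfl⟩ v₁ v₂ h₁ h₂
    rw [hφ g v₁ v₂ h₁ h₂, map_one]
  refine ⟨?_, ?_, hfree, ?_⟩
  · refine discreteTopology_iff_isOpen_singleton.2 fun g => ?_
    -- By freeness an element is determined by its values at the vertices $1$ of the two trees, and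
    -- prescribing these is an open condition.
    have : ({g} : Set φ.range) =
        Subtype.val ⁻¹' ({x | x 1 = g.1.1 1} ×ˢ {x | x 1 = g.1.2 1}) := by
      ext h
      constructor
      · rintro rfl
        exact ⟨rfl, rfl⟩
      · rintro ⟨h₁, h₂⟩
        have h₁ : h.1.1 1 = g.1.1 1 := h₁
        have h₂ : h.1.2 1 = g.1.2 1 := h₂
        have := hfree _ (g⁻¹ * h).2 1 1 (by simp [h₁, ← RelIso.mul_apply])
          (by simp [h₂, ← RelIso.mul_apply])
        exact (inv_mul_eq_one.1 (Subtype.ext this)).symm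
    rw [this]
    exact ((isOpen_setOf_apply_eq _ _ _).prod (isOpen_setOf_apply_eq _ _ _)).preimage
      continuous_subtype_val
  · rintro ⟨_, g, rfl⟩ hne hfin
    refine hne (Subtype.ext ?_)
    have hg : IsOfFinOrder g := hinj.isOfFinOrder_iff.1 (φ.range.subtype.isOfFinOrder hfin)
    have : g = 1 := Prod.ext ((isOfFinOrder_iff_eq_one _).1 hg.fst)
      ((isOfFinOrder_iff_eq_one _).1 hg.snd)
    simp [this]
  · intro v₁ w₁ v₂ w₂
    exact ⟨φ (w₁⁻¹ * v₁, w₂⁻¹ * v₂), ⟨_, rfl⟩,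
      show v₁ * (w₁⁻¹ * v₁)⁻¹ = w₁ by group, show v₂ * (w₂⁻¹ * v₂)⁻¹ = w₂ by group⟩

end BMType

/-! ### Contractibility of the realization of a rooted tree. -/

open Topology unitInterval

namespace BMType

/-- The left and the right end of the unit interval. -/
def endpoint (b : Bool) : I := bif b then 1 else 0

/-- In the disjoint union of unit intervals, one for each edge of a graph, the ends that carry the
same vertex are identified. -/
inductive EndRel {D V : Type*} (ends : D → Bool → V) : (Σ _ : D, I) → (Σ _ : D, I) → Prop
  | glue (d d' : D) (b b' : Bool) (h : ends d b = ends d' b') :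
      EndRel ends ⟨d, endpoint b⟩ ⟨d', endpoint b'⟩

/-- The topological realization of a graph that is given by the ends of its edges. -/
def Realization {D V : Type*} (ends : D → Bool → V) : Type _ := Quot (EndRel ends)

instance {D V : Type*} (ends : D → Bool → V) : TopologicalSpace (Realization ends) :=
  inferInstanceAs (TopologicalSpace (Quot (EndRel ends)))

namespace Realization

variable {D V : Type*} {ends : D → Bool → V}

/-- The point with parameter `t` on the edge `d`. -/
def point (ends : D → Bool → V) (d : D) (t : I) : Realization ends := Quot.mk _ ⟨d, t⟩

theorem point_endpoint {d d' : D} {b b' : Bool} (h : ends d b = ends d' b') :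
    point ends d (endpoint b) = point ends d' (endpoint b') :=
  Quot.sound (EndRel.glue d d' b b' h)

theorem exists_point (p : Realization ends) : ∃ d t, point ends d t = p := by
  obtain ⟨⟨d, t⟩, rfl⟩ := Quot.exists_rep p
  exact ⟨d, t, rfl⟩

theorem isQuotientMap_mk :
    IsQuotientMap (fun p : Σ _ : D, I => point ends p.1 p.2) := isQuotientMap_quot_mk

theorem continuous_point (d : D) : Continuous (point ends d) :=
  continuous_quot_mk.comp (@continuous_sigmaMk D (fun _ => I) _ d)

theorem continuous_of_continuous_point {X : Type*} [TopologicalSpace X] {f : Realization ends → X}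
    (h : ∀ d, Continuous fun t => f (point ends d t)) : Continuous f :=
  isQuotientMap_mk.continuous_iff.2 (continuous_sigma h)

end Realization

/-- A graph with an orientation of its edges in which every vertex but the root is the upper end of
exactly one edge, and in which the rank increases along the edges. -/
structure Rooted {D V : Type*} (ends : D → Bool → V) where
  up : D → Bool
  root : V
  rank : V → ℕ
  rank_lt : ∀ d, rank (ends d (!up d)) < rank (ends d (up d))
  injective : Function.Injective fun d => ends d (up d)
  surjective : ∀ v, v ≠ root → ∃ d, ends d (up d) = v

namespace Rooted

variable {D V : Type*} {ends : D → Bool → V} (R : Rooted ends)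

/-- The upper end of an edge. -/
def hi (d : D) : V := ends d (R.up d)

/-- The lower end of an edge. -/
def lo (d : D) : V := ends d (!R.up d)

theorem rank_lo_lt (d : D) : R.rank (R.lo d) < R.rank (R.hi d) := R.rank_lt d

/-- The height of a vertex: a number in `[0, 1)` that increases with the rank. -/
noncomputable def height (v : V) : ℝ := 1 - 1 / ((R.rank v : ℝ) + 1)

theorem height_nonneg (v : V) : 0 ≤ R.height v := by
  have : 1 / ((R.rank v : ℝ) + 1) ≤ 1 := by
    rw [div_le_one (by positivity)]
    linarith [(R.rank v).cast_nonneg (α := ℝ)]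
  unfold height
  linarith

theorem height_le_one (v : V) : R.height v ≤ 1 := by
  have : 0 ≤ 1 / ((R.rank v : ℝ) + 1) := by positivity
  unfold height
  linarith

theorem height_lo_lt (d : D) : R.height (R.lo d) < R.height (R.hi d) := by
  have h : (R.rank (R.lo d) : ℝ) < R.rank (R.hi d) := by exact_mod_cast R.rank_lo_lt d
  unfold height
  gcongr

/-- The edge `d`, as a path from its lower to its upper end. -/
noncomputable def edgePath (d : D) (s : ℝ) : Realization ends :=
  Realization.point ends d
    (if R.up d then Set.projIcc 0 1 zero_le_one s else σ (Set.projIcc 0 1 zero_le_one s))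

theorem continuous_edgePath (d : D) : Continuous (R.edgePath d) := by
  refine (Realization.continuous_point d).comp ?_
  split_ifs
  · exact continuous_projIcc
  · exact continuous_symm.comp continuous_projIcc

theorem edgePath_of_nonpos (d : D) {s : ℝ} (hs : s ≤ 0) :
    R.edgePath d s = Realization.point ends d (endpoint (!R.up d)) := by
  unfold edgePath
  rw [Set.projIcc_of_le_left _ hs]
  cases R.up d <;> simp [endpoint]

theorem edgePath_of_one_le (d : D) {s : ℝ} (hs : 1 ≤ s) :
    R.edgePath d s = Realization.point ends d (endpoint (R.up d)) := by
  unfold edgePath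
  rw [Set.projIcc_of_right_le _ hs]
  cases R.up d <;> simp [endpoint]

open Classical in
/-- The points of the realization below a vertex, parametrized by their height: the path that
leads from the root to `v`, and stays at `v`. -/
noncomputable def ray (ν : V → Realization ends) (v : V) : ℝ → Realization ends :=
  if h : ∃ d, R.hi d = v then fun s =>
    if s ≤ R.height (R.lo h.choose) then ray ν (R.lo h.choose) s
    else R.edgePath h.choose
      ((s - R.height (R.lo h.choose)) / (R.height v - R.height (R.lo h.choose)))
  else fun _ => ν v
termination_by R.rank v
decreasing_by
  have := R.rank_lo_lt h.choose
  rwa [h.choose_spec] at this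

variable {ν : V → Realization ends}

theorem ray_hi (d : D) (s : ℝ) : R.ray ν (R.hi d) s =
    if s ≤ R.height (R.lo d) then R.ray ν (R.lo d) s
    else R.edgePath d
      ((s - R.height (R.lo d)) / (R.height (R.hi d) - R.height (R.lo d))) := by
  have h : ∃ d', R.hi d' = R.hi d := ⟨d, rfl⟩
  rw [ray, dif_pos h, R.injective h.choose_spec]

theorem eq_root_of_forall_ne {v : V} (h : ¬ ∃ d, R.hi d = v) : v = R.root := by
  by_contra hv
  exact h (R.surjective v hv)

theorem ray_of_not (v : V) (h : ¬ ∃ d, R.hi d = v) (s : ℝ) : R.ray ν v s = ν v := by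
  rw [ray, dif_neg h]

/-- Induction from the root upwards. -/
theorem induction {P : V → Prop} (h₀ : ∀ v, (¬ ∃ d, R.hi d = v) → P v)
    (h : ∀ d, P (R.lo d) → P (R.hi d)) (v : V) : P v := by
  induction hn : R.rank v using Nat.strong_induction_on generalizing v with
  | _ n ih =>
    by_cases hv : ∃ d, R.hi d = v
    · obtain ⟨d, rfl⟩ := hv
      exact h d (ih _ (hn ▸ R.rank_lo_lt d) _ rfl)
    · exact h₀ v hv

variable (hν : ∀ d b, ν (ends d b) = Realization.point ends d (endpoint b))
include hν

theorem ray_of_height_le (v : V) {s : ℝ} (hs : R.height v ≤ s) : R.ray ν v s = ν v := by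
  by_cases hv : ∃ d, R.hi d = v
  · obtain ⟨d, rfl⟩ := hv
    have h := R.height_lo_lt d
    rw [ray_hi, if_neg (by linarith), edgePath_of_one_le, hi, hν]
    rw [one_le_div (by linarith)]
    linarith
  · exact R.ray_of_not v hv s

theorem continuous_ray (v : V) : Continuous (R.ray ν v) := by
  refine R.induction (P := fun v => Continuous (R.ray ν v)) (fun v hv => ?_) (fun d hd => ?_) v
  · rw [funext (R.ray_of_not (ν := ν) v hv)]
    exact continuous_const
  · rw [funext (R.ray_hi (ν := ν) d)]
    refine Continuous.if_le hd ((R.continuous_edgePath d).comp (by fun_prop))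
      continuous_id continuous_const ?_
    -- At the height of the lower end, both formulas give the lower vertex.
    rintro _ rfl
    rw [R.ray_of_height_le hν _ le_rfl, sub_self, zero_div, R.edgePath_of_nonpos d le_rfl, lo, hν]

omit hν in
theorem ray_zero (v : V) : R.ray ν v 0 = ν R.root := by
  refine R.induction (P := fun v => R.ray ν v 0 = ν R.root) (fun v hv => ?_) (fun d hd => ?_) v
  · rw [R.ray_of_not v hv, R.eq_root_of_forall_ne hv]
  · rw [ray_hi, if_pos (R.height_nonneg _), hd]

omit hν in
/-- The height of a point on the edge `d`. -/
noncomputable def edgeHeight (d : D) (t : I) : ℝ :=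
  R.height (R.lo d) +
    (if R.up d then (t : ℝ) else 1 - t) * (R.height (R.hi d) - R.height (R.lo d))

omit hν in
theorem continuous_edgeHeight (d : D) : Continuous (R.edgeHeight d) := by
  unfold edgeHeight
  split_ifs <;> fun_prop

omit hν in
theorem edgeHeight_endpoint (d : D) (b : Bool) :
    R.edgeHeight d (endpoint b) = R.height (ends d b) := by
  unfold edgeHeight lo hi
  cases h : R.up d <;> cases b <;> simp [endpoint]

omit hν in
theorem edgeHeight_mem (d : D) (t : I) :
    R.edgeHeight d t ∈ Set.Icc (R.height (R.lo d)) (R.height (R.hi d)) := by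
  have h := R.height_lo_lt d
  have h0 := t.2.1
  have h1 := t.2.2
  unfold edgeHeight
  split_ifs <;> constructor <;> nlinarith

theorem ray_edgeHeight (d : D) (t : I) :
    R.ray ν (R.hi d) (R.edgeHeight d t) = Realization.point ends d t := by
  have h := R.height_lo_lt d
  have h' : R.height (R.hi d) - R.height (R.lo d) ≠ 0 := by linarith
  rw [ray_hi]
  split_ifs with hle
  · have heq : R.edgeHeight d t = R.height (R.lo d) := le_antisymm hle (R.edgeHeight_mem d t).1
    have ht : t = endpoint (!R.up d) := by
      have : (if R.up d then (t : ℝ) else 1 - t) = 0 := by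
        unfold edgeHeight at heq
        exact (mul_eq_zero.1 (add_eq_left.1 heq)).resolve_right h'
      apply Subtype.ext
      cases hu : R.up d
      · rw [hu, if_neg Bool.false_ne_true] at this
        change (t : ℝ) = 1
        linarith
      · rwa [hu, if_pos rfl] at this
    rw [heq, R.ray_of_height_le hν _ le_rfl, lo, hν, ht]
  · have : (R.edgeHeight d t - R.height (R.lo d)) / (R.height (R.hi d) - R.height (R.lo d)) =
        if R.up d then (t : ℝ) else 1 - t := by
      unfold edgeHeight
      field_simp
      ring
    rw [this, edgePath]
    congr 1
    split_ifs
    · exact Set.projIcc_val _ t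
    · have : (1 - t : ℝ) = (σ t : I) := rfl
      rw [this, Set.projIcc_val, unitInterval.symm_symm]

/-- The right side depends on the vertex `ends d b` only, so the contraction is well defined where
edges meet. -/
theorem ray_min_edgeHeight_endpoint (d : D) (b : Bool) (s : ℝ) :
    R.ray ν (R.hi d) (min s (R.edgeHeight d (endpoint b))) = R.ray ν (ends d b) s := by
  have key : ∀ v, R.ray ν v (min s (R.height v)) = R.ray ν v s := by
    intro v
    rcases le_total s (R.height v) with h | h
    · rw [min_eq_left h]
    · rw [min_eq_right h, R.ray_of_height_le hν v h, R.ray_of_height_le hν v le_rfl]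
  rw [edgeHeight_endpoint, ← key (ends d b)]
  by_cases hb : b = R.up d
  · rw [hb]
    rfl
  · obtain rfl : b = !R.up d := by simpa [Bool.eq_not] using hb
    change R.ray ν (R.hi d) (min s (R.height (R.lo d))) = R.ray ν (R.lo d) _
    rw [ray_hi, if_pos (min_le_right _ _)]
    rfl

-- At time $s$ a point of height $h$ sits at height $\min(s,h)$ on its path from the root. Since
-- heights lie in $[0,1]$, time $0$ gives the root and time $1$ the identity.
include R in
theorem contractibleSpace : ContractibleSpace (Realization ends) := by
  let G : Realization ends → C(I, Realization ends) := Quot.lift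
    (fun p => ⟨fun s => R.ray ν (R.hi p.1) (min s (R.edgeHeight p.1 p.2)),
      (R.continuous_ray hν _).comp (by fun_prop)⟩) (by
      rintro _ _ ⟨d, d', b, b', h⟩
      ext s
      simp only [ContinuousMap.coe_mk]
      rw [R.ray_min_edgeHeight_endpoint hν, R.ray_min_edgeHeight_endpoint hν, h])
  have hG : Continuous G := by
    refine Realization.continuous_of_continuous_point fun d => ?_
    refine (ContinuousMap.curry ⟨fun p : I × I =>
      R.ray ν (R.hi d) (min p.2 (R.edgeHeight d p.1)), ?_⟩).continuous
    have := R.continuous_edgeHeight d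
    exact (R.continuous_ray hν _).comp (by fun_prop)
  refine (contractible_iff_id_nullhomotopic _).2 ⟨ν R.root, ContinuousMap.Homotopic.symm ⟨?_⟩⟩
  refine ⟨⟨fun p => G p.2 p.1, ?_⟩, fun p => ?_, fun p => ?_⟩
  · exact (ContinuousMap.continuous_uncurry_of_continuous ⟨G, hG⟩).comp continuous_swap
  · obtain ⟨d, t, rfl⟩ := Realization.exists_point p
    change R.ray ν (R.hi d) (min ((0 : I) : ℝ) (R.edgeHeight d t)) = ν R.root
    rw [Set.Icc.coe_zero, min_eq_left ((R.height_nonneg _).trans (R.edgeHeight_mem d t).1),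
      R.ray_zero]
  · obtain ⟨d, t, rfl⟩ := Realization.exists_point p
    change R.ray ν (R.hi d) (min ((1 : I) : ℝ) (R.edgeHeight d t)) = Realization.point ends d t
    rw [Set.Icc.coe_one, min_eq_right ((R.edgeHeight_mem d t).2.trans (R.height_le_one _)),
      R.ray_edgeHeight hν]

end Rooted

end BMType

namespace BMType

/-! ### The universal covering of a theta graph -/

/-- The trivial element followed by the generators of a free group. -/
def gen (k : ℕ) : Fin (k + 1) → FreeGroup (Fin k) := Fin.cons 1 FreeGroup.of

/-- The tree with two vertices `(g, false)` and `(g, true)` for every `g` in the free group of rank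
`k`, and with an edge from `(g, false)` to `(gen k m * g, true)` for every `m`. -/
def thetaEnds (k : ℕ) (e : FreeGroup (Fin k) × Fin (k + 1)) (b : Bool) :
    FreeGroup (Fin k) × Bool :=
  (bif b then gen k e.2 * e.1 else e.1, b)

/-- The sign of the first letter of a reduced word. -/
def firstSign {α : Type*} [DecidableEq α] (g : FreeGroup α) : Bool :=
  -- The path from the root enters the pair $(g,\cdot)$ at the vertex `(g, firstSign g)`. The
  -- default `false` makes this the root itself when $g=1$.
  (g.toWord.head?.map Prod.snd).getD false

/-- The upper end of an edge. -/
def thetaUp (k : ℕ) (e : FreeGroup (Fin k) × Fin (k + 1)) : Bool :=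
  -- Edge $0$ leads away from the entry vertex of its pair. Any other edge leads to its `true` end,
  -- unless multiplication by its generator cancels the first letter.
  Fin.cases (motive := fun _ => Bool) (!firstSign e.1)
    (fun i => decide (e.1.toWord.head? ≠ some (i, false))) e.2

theorem thetaEnds_zero (k : ℕ) (g : FreeGroup (Fin k)) (b : Bool) :
    thetaEnds k (g, 0) b = (g, b) := by
  cases b <;> simp [thetaEnds, gen]

theorem thetaEnds_true (k : ℕ) (g : FreeGroup (Fin k)) (i : Fin k) :
    thetaEnds k (g, i.succ) true = (FreeGroup.mk [(i, true)] * g, true) := by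
  simp only [thetaEnds, gen, Fin.cons_succ, cond_true]
  rfl

theorem thetaEnds_false (k : ℕ) (g : FreeGroup (Fin k)) (m : Fin (k + 1)) :
    thetaEnds k (g, m) false = (g, false) := rfl

theorem thetaUp_zero (k : ℕ) (g : FreeGroup (Fin k)) : thetaUp k (g, 0) = !firstSign g := rfl

theorem thetaUp_succ_of_head {k : ℕ} {g : FreeGroup (Fin k)} {i : Fin k}
    (h : g.toWord.head? = some (i, false)) : thetaUp k (g, i.succ) = false := by
  simp [thetaUp, h]

theorem thetaUp_succ_of_not_head {k : ℕ} {g : FreeGroup (Fin k)} {i : Fin k}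
    (h : g.toWord.head? ≠ some (i, false)) : thetaUp k (g, i.succ) = true := by
  simp [thetaUp, h]

theorem firstSign_of_head {α : Type*} [DecidableEq α] {g : FreeGroup α} {i : α} {b : Bool}
    (h : g.toWord.head? = some (i, b)) : firstSign g = b := by
  simp [firstSign, h]

theorem head_mk_singleton_mul {α : Type*} [DecidableEq α] {g : FreeGroup α} {w : α × Bool}
    (h : g.toWord.head? ≠ some (w.1, !w.2)) : (FreeGroup.mk [w] * g).toWord.head? = some w := by
  rw [FreeGroup.toWord_mk_singleton_mul, if_neg h, List.head?_cons]

/-- The upper end of an edge of the tree, described by cases. -/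
theorem theta_up_cases (k : ℕ) (e : FreeGroup (Fin k) × Fin (k + 1)) :
    (e.2 = 0 ∧ thetaEnds k e (thetaUp k e) = (e.1, !firstSign e.1)) ∨
    (∃ i : Fin k, e.2 = i.succ ∧ e.1.toWord.head? = some (i, false) ∧
      thetaEnds k e (thetaUp k e) = (e.1, false)) ∨
    (∃ i : Fin k, e.2 = i.succ ∧ e.1.toWord.head? ≠ some (i, false) ∧
      thetaEnds k e (thetaUp k e) = (FreeGroup.mk [(i, true)] * e.1, true)) := by
  obtain ⟨g, m⟩ := e
  cases m using Fin.cases with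
  | zero => exact .inl ⟨rfl, by rw [thetaEnds_zero, thetaUp_zero]⟩
  | succ i =>
    by_cases h : g.toWord.head? = some (i, false)
    · exact .inr (.inl ⟨i, rfl, h, by rw [thetaUp_succ_of_head h, thetaEnds_false]⟩)
    · exact .inr (.inr ⟨i, rfl, h, by rw [thetaUp_succ_of_not_head h, thetaEnds_true]⟩)

/-- The rank of a vertex: the distance from `(1, false)`, if the edges with `m = 0` are drawn twice
where they are needed. -/
def thetaRank (k : ℕ) (v : FreeGroup (Fin k) × Bool) : ℕ :=
  2 * v.1.norm + if v.2 = firstSign v.1 then 0 else 1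

/-- Along an edge with $m\ne 0$ the norm changes by exactly one, and the factor $2$ outweighs the
summand $0$ or $1$. -/
theorem thetaRank_lt (k : ℕ) (e : FreeGroup (Fin k) × Fin (k + 1)) :
    thetaRank k (thetaEnds k e (!thetaUp k e)) < thetaRank k (thetaEnds k e (thetaUp k e)) := by
  have hle : ∀ v, thetaRank k v ≤ 2 * v.1.norm + 1 := by
    intro v
    unfold thetaRank
    split_ifs <;> omega
  have hge : ∀ v, 2 * v.1.norm ≤ thetaRank k v := fun v => Nat.le_add_right _ _
  obtain ⟨g, m⟩ := e
  cases m using Fin.cases with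
  | zero =>
    rw [thetaEnds_zero, thetaEnds_zero, thetaUp_zero]
    simp [thetaRank]
  | succ i =>
    by_cases h : g.toWord.head? = some (i, false)
    · rw [thetaUp_succ_of_head h, Bool.not_false, thetaEnds_true, thetaEnds_false]
      have h₁ := hle (FreeGroup.mk [(i, true)] * g, true)
      have h₂ := hge (g, false)
      have h₃ := FreeGroup.norm_mk_singleton_mul_of_head (w := (i, true)) h
      simp only at h₁ h₂
      omega
    · rw [thetaUp_succ_of_not_head h, Bool.not_true, thetaEnds_true, thetaEnds_false]
      have h₁ := hge (FreeGroup.mk [(i, true)] * g, true)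
      have h₂ := hle (g, false)
      have h₃ := FreeGroup.norm_mk_singleton_mul_of_not_head (w := (i, true)) h
      simp only at h₁ h₂
      omega

/-- The vertex tells its parent edge: edge $0$ if its sign differs from `firstSign`, otherwise the
edge of the first letter. -/
theorem theta_up_injective (k : ℕ) : Function.Injective fun e => thetaEnds k e (thetaUp k e) := by
  rintro ⟨g, m⟩ ⟨g', m'⟩ h
  simp only at h
  have hs : ∀ (g : FreeGroup (Fin k)) i, g.toWord.head? ≠ some (i, false) →
      firstSign (FreeGroup.mk [(i, true)] * g) = true := fun g i hg =>
    firstSign_of_head (head_mk_singleton_mul (w := (i, true)) hg)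
  rcases theta_up_cases k (g, m) with ⟨h₁, h₂⟩ | ⟨i, h₁, h₂, h₃⟩ | ⟨i, h₁, h₂, h₃⟩ <;>
  rcases theta_up_cases k (g', m') with ⟨h₁', h₂'⟩ | ⟨i', h₁', h₂', h₃'⟩ | ⟨i', h₁', h₂', h₃'⟩ <;>
  simp only at h₁ h₁' h₂ h₂' <;> subst h₁ <;> subst h₁'
  · rw [h₂, h₂', Prod.mk.injEq] at h
    rw [h.1]
  · rw [h₂, h₃', Prod.mk.injEq] at h
    rw [h.1, firstSign_of_head h₂'] at h
    simp at h
  · rw [h₂, h₃', Prod.mk.injEq] at h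
    rw [h.1, hs _ _ h₂'] at h
    simp at h
  · rw [h₃, h₂', Prod.mk.injEq] at h
    rw [← h.1, firstSign_of_head h₂] at h
    simp at h
  · rw [h₃, h₃', Prod.mk.injEq] at h
    simp only at h
    rw [h.1, h₂', Option.some.injEq, Prod.mk.injEq] at h₂
    rw [h.1, h₂.1]
  · rw [h₃, h₃', Prod.mk.injEq] at h
    simp at h
  · rw [h₃, h₂', Prod.mk.injEq] at h
    rw [← h.1, hs _ _ h₂] at h
    simp at h
  · rw [h₃, h₃', Prod.mk.injEq] at h
    simp at h
  · rw [h₃, h₃', Prod.mk.injEq] at h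
    simp only at h
    have := head_mk_singleton_mul (w := (i, true)) h₂
    rw [h.1, head_mk_singleton_mul (w := (i', true)) h₂', Option.some.injEq, Prod.mk.injEq] at this
    obtain rfl := this.1
    rw [mul_left_cancel h.1]

theorem theta_up_surjective (k : ℕ) (v : FreeGroup (Fin k) × Bool) (hv : v ≠ (1, false)) :
    ∃ e, thetaEnds k e (thetaUp k e) = v := by
  obtain ⟨g, b⟩ := v
  by_cases hb : b = firstSign g
  · rcases hg : g.toWord.head? with _ | ⟨i, c⟩
    · have : g = 1 := by
        rw [← FreeGroup.toWord_eq_nil_iff]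
        exact List.head?_eq_none_iff.1 hg
      subst this
      exact absurd (by rw [hb]; rfl) hv
    · obtain rfl : b = c := hb.trans (firstSign_of_head hg)
      cases b
      · exact ⟨(g, i.succ), by rw [thetaUp_succ_of_head hg, thetaEnds_false]⟩
      · have h₁ := FreeGroup.norm_mk_singleton_mul_of_head (w := (i, false)) hg
        have h₂ := FreeGroup.mk_singleton_not_mul_cancel (i, false) g
        simp only [Bool.not_false] at h₂
        -- The lower end is $g$ without its first letter. What remains cannot start with the inverse
        -- of that letter, since restoring the letter raises the norm.
        refine ⟨(FreeGroup.mk [(i, false)] * g, i.succ), ?_⟩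
        rw [thetaUp_succ_of_not_head, thetaEnds_true, h₂]
        intro h
        have h₃ := FreeGroup.norm_mk_singleton_mul_of_head (w := (i, true)) h
        rw [h₂] at h₃
        omega
  · refine ⟨(g, 0), ?_⟩
    rw [thetaEnds_zero, thetaUp_zero]
    simpa [Bool.eq_not, eq_comm] using hb

/-- The tree is rooted at `(1, false)`. -/
def thetaRooted (k : ℕ) : Rooted (thetaEnds k) where
  up := thetaUp k
  root := (1, false)
  rank := thetaRank k
  rank_lt := thetaRank_lt k
  injective := theta_up_injective k
  surjective := theta_up_surjective k

/-- The realization of the tree. -/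
abbrev ThetaTree (k : ℕ) : Type := Realization (thetaEnds k)

instance (k : ℕ) : ContractibleSpace (ThetaTree k) :=
  (thetaRooted k).contractibleSpace
    -- Each vertex is represented as an end of the edge with index $0$ there.
    (ν := fun v => Realization.point _ (bif v.2 then (gen k 0)⁻¹ * v.1 else v.1, 0) (endpoint v.2))
    fun d b => Realization.point_endpoint (by cases b <;> simp [thetaEnds])

variable {k : ℕ}

/-- Edges are attached by left multiplication, with which right multiplication commutes. -/
instance : MulAction (FreeGroup (Fin k)) (ThetaTree k) where
  smul h := Quot.map (fun p => ⟨(p.1.1 * h⁻¹, p.1.2), p.2⟩) (by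
    rintro _ _ ⟨d, d', b, b', hd⟩
    refine EndRel.glue _ _ b b' ?_
    simp only [thetaEnds, Prod.mk.injEq] at hd ⊢
    obtain ⟨h₁, rfl⟩ := hd
    cases b <;> simp_all [← mul_assoc])
  one_smul p := by
    obtain ⟨d, t, rfl⟩ := Realization.exists_point p
    change Realization.point _ (d.1 * 1⁻¹, d.2) t = _
    simp
  mul_smul g h p := by
    obtain ⟨d, t, rfl⟩ := Realization.exists_point p
    change Realization.point _ (d.1 * (g * h)⁻¹, d.2) t =
      Realization.point _ (d.1 * h⁻¹ * g⁻¹, d.2) t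
    simp [mul_assoc]

theorem smul_point (h : FreeGroup (Fin k)) (d : FreeGroup (Fin k) × Fin (k + 1)) (t : I) :
    h • Realization.point (thetaEnds k) d t = Realization.point _ (d.1 * h⁻¹, d.2) t := rfl

instance : ContinuousConstSMul (FreeGroup (Fin k)) (ThetaTree k) where
  continuous_const_smul h := Realization.continuous_of_continuous_point fun d =>
    Realization.continuous_point (d.1 * h⁻¹, d.2)

/-- The open star of the vertex `(v, b)`. -/
def star (v : FreeGroup (Fin k)) (b : Bool) : Set (ThetaTree k) :=
  Quot.lift (fun p => p.2 ≠ endpoint (!b) ∧ (thetaEnds k p.1 b).1 = v) (by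
    rintro _ _ ⟨d, d', c, c', h⟩
    obtain rfl : c = c' := congrArg Prod.snd h
    by_cases hc : c = b
    · rw [hc] at h
      simp only [hc, h]
    · obtain rfl : c = !b := by simpa [Bool.eq_not] using hc
      simp)

theorem point_mem_star {v : FreeGroup (Fin k)} {b : Bool} {d : FreeGroup (Fin k) × Fin (k + 1)}
    {t : I} : Realization.point (thetaEnds k) d t ∈ star v b ↔
      t ≠ endpoint (!b) ∧ (thetaEnds k d b).1 = v := Iff.rfl

theorem isOpen_star (v : FreeGroup (Fin k)) (b : Bool) : IsOpen (star v b) := by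
  refine Realization.isQuotientMap_mk.isOpen_preimage.1 (isOpen_sigma_iff.2 fun d => ?_)
  change IsOpen {t | t ≠ endpoint (!b) ∧ (thetaEnds k d b).1 = v}
  exact isOpen_ne.and isOpen_const

theorem eq_one_of_smul_mem_star {v : FreeGroup (Fin k)} {b : Bool} {h : FreeGroup (Fin k)}
    {p : ThetaTree k} (hp : p ∈ star v b) (hp' : h • p ∈ star v b) : h = 1 := by
  obtain ⟨d, t, rfl⟩ := Realization.exists_point p
  rw [smul_point] at hp'
  have := (point_mem_star.1 hp').2.trans (point_mem_star.1 hp).2.symm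
  cases b <;> simpa [thetaEnds] using this

/-! ### Theta graphs -/

/-- The point with parameter `t` on the edge `m` of a theta graph in Euclidean space. -/
def thetaMap {n : ℕ} (p : Fin n × I) : I × (Fin n → ℝ) :=
  -- The function $t(1-t)$ vanishes only at the ends, so distinct edges meet only there. As a
  -- subspace of a Hausdorff space the graph is Hausdorff.
  (p.2, Pi.single p.1 ((p.2 : ℝ) * (1 - p.2)))

theorem continuous_thetaMap {n : ℕ} : Continuous (thetaMap (n := n)) := by
  refine continuous_prod_of_discrete_left.2 fun m => ?_
  refine continuous_id.prodMk ?_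
  exact (continuous_single m).comp (by fun_prop)

theorem thetaMap_eq_iff {n : ℕ} {p q : Fin n × I} :
    thetaMap p = thetaMap q ↔ p.2 = q.2 ∧ (p.1 = q.1 ∨ p.2 = 0 ∨ p.2 = 1) := by
  obtain ⟨m, t⟩ := p
  obtain ⟨m', t'⟩ := q
  simp only [thetaMap, Prod.mk.injEq]
  refine and_congr_right ?_
  rintro rfl
  constructor
  · intro h
    by_cases hm : m = m'
    · exact .inl hm
    · have := congrFun h m
      rw [Pi.single_eq_same, Pi.single_eq_of_ne hm, mul_eq_zero] at this
      refine .inr (this.imp (fun h => Subtype.ext h) fun h => Subtype.ext ?_)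
      change (t : ℝ) = 1
      linarith
  · rintro (rfl | rfl | rfl) <;> simp

/-- The theta graph with `n` edges. -/
abbrev Theta (n : ℕ) : Type := Set.range (thetaMap (n := n))

/-- The point with parameter `t` on the edge `m` of a theta graph. -/
def thetaPoint {n : ℕ} (p : Fin n × I) : Theta n := ⟨thetaMap p, p, rfl⟩

theorem continuous_thetaPoint {n : ℕ} : Continuous (thetaPoint (n := n)) :=
  continuous_thetaMap.subtype_mk _

theorem thetaPoint_surjective {n : ℕ} : Function.Surjective (thetaPoint (n := n)) := by
  rintro ⟨_, p, rfl⟩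
  exact ⟨p, rfl⟩

theorem thetaPoint_eq_iff {n : ℕ} {p q : Fin n × I} :
    thetaPoint p = thetaPoint q ↔ p.2 = q.2 ∧ (p.1 = q.1 ∨ p.2 = 0 ∨ p.2 = 1) :=
  Subtype.mk_eq_mk.trans thetaMap_eq_iff

/-- The covering of the theta graph by the tree. -/
def thetaCover (k : ℕ) : ThetaTree k → Theta (k + 1) :=
  Quot.lift (fun p => thetaPoint (p.1.2, p.2)) (by
    rintro _ _ ⟨d, d', b, b', h⟩
    obtain rfl : b = b' := congrArg Prod.snd h
    refine thetaPoint_eq_iff.2 ⟨rfl, .inr ?_⟩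
    cases b
    exacts [.inl rfl, .inr rfl])

theorem thetaCover_point (d : FreeGroup (Fin k) × Fin (k + 1)) (t : I) :
    thetaCover k (Realization.point _ d t) = thetaPoint (d.2, t) := rfl

theorem continuous_thetaCover : Continuous (thetaCover k) :=
  Realization.continuous_of_continuous_point fun d =>
    continuous_thetaPoint.comp (by fun_prop : Continuous fun t : I => (d.2, t))

theorem isQuotientCoveringMap_thetaCover :
    IsQuotientCoveringMap (thetaCover k) (FreeGroup (Fin k)) where
  toIsQuotientMap := by
    -- The edges based at $g=1$ lift `thetaPoint`, which is a quotient map from a compact space to a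
    -- Hausdorff space.
    have h : Continuous fun p : Fin (k + 1) × I =>
        Realization.point (thetaEnds k) (1, p.1) p.2 :=
      continuous_prod_of_discrete_left.2 fun m => Realization.continuous_point (1, m)
    exact IsQuotientMap.of_comp h continuous_thetaCover
      (continuous_thetaPoint.isClosedMap.isQuotientMap continuous_thetaPoint thetaPoint_surjective)
  continuous_const_smul := continuous_const_smul
  apply_eq_iff_mem_orbit {p q} := by
    obtain ⟨⟨g, m⟩, t, rfl⟩ := Realization.exists_point p
    obtain ⟨⟨g', m'⟩, t', rfl⟩ := Realization.exists_point q
    rw [thetaCover_point, thetaCover_point, thetaPoint_eq_iff]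
    constructor
    · rintro ⟨ht, hm⟩
      simp only at ht hm
      subst ht
      rcases hm with rfl | rfl | rfl
      · exact ⟨g⁻¹ * g', by simp [smul_point]⟩
      · exact ⟨g⁻¹ * g', Realization.point_endpoint (b := false) (b' := false)
          (by simp [thetaEnds])⟩
      · exact ⟨(gen k m * g)⁻¹ * (gen k m' * g'),
          Realization.point_endpoint (b := true) (b' := true) (by simp [thetaEnds, mul_assoc])⟩
    · rintro ⟨h, hh⟩
      rw [← thetaPoint_eq_iff (p := (m, t)) (q := (m', t')), ← thetaCover_point (g, m),
        ← thetaCover_point (g', m'), ← hh]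
      rfl
  disjoint p := by
    obtain ⟨d, t, rfl⟩ := Realization.exists_point p
    -- Every point lies in the open star of an end of its edge, and nontrivial translates of a star
    -- are disjoint from it.
    obtain ⟨b, hb⟩ : ∃ b, t ≠ endpoint (!b) := by
      by_cases ht : t = 0
      · exact ⟨false, by simp [endpoint, ht]⟩
      · exact ⟨true, ht⟩
    refine ⟨star _ b, (isOpen_star _ b).mem_nhds (point_mem_star.2 ⟨hb, rfl⟩), ?_⟩
    rintro h ⟨_, ⟨q, hq, rfl⟩, hq'⟩
    exact eq_one_of_smul_mem_star hq hq'

end BMType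

/-! ### The polyhedron as a product, and products of coverings. -/

namespace BMType

/-- The product of two actions, as an action of the product of the groups. -/
@[reducible]
def prodMulAction (G H E F : Type*) [Group G] [Group H] [MulAction G E] [MulAction H F] :
    MulAction (G × H) (E × F) where
  smul g p := (g.1 • p.1, g.2 • p.2)
  one_smul p := Prod.ext (one_smul G p.1) (one_smul H p.2)
  mul_smul g h p := Prod.ext (mul_smul g.1 h.1 p.1) (mul_smul g.2 h.2 p.2)

/-- The product of two quotient coverings is a quotient covering. -/
theorem isQuotientCoveringMap_prodMap {G H E F X Y : Type*} [Group G] [Group H]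
    [TopologicalSpace E] [TopologicalSpace F] [TopologicalSpace X] [TopologicalSpace Y]
    [MulAction G E] [MulAction H F] {f : E → X} {f' : F → Y}
    (hf : IsQuotientCoveringMap f G) (hf' : IsQuotientCoveringMap f' H) :
    @IsQuotientCoveringMap _ _ _ _ (Prod.map f f') (G × H) _ (prodMulAction G H E F) := by
  let _ := prodMulAction G H E F
  have hs : ∀ (g : G × H) (p : E × F), g • p = (g.1 • p.1, g.2 • p.2) := fun _ _ => rfl
  have := hf.toContinuousConstSMul
  have := hf'.toContinuousConstSMul
  refine { toIsQuotientMap := (hf.isOpenQuotientMap.prodMap hf'.isOpenQuotientMap).isQuotientMap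
           continuous_const_smul := fun g => ?_
           apply_eq_iff_mem_orbit := fun {p q} => ?_
           disjoint := fun p => ?_ }
  · exact ((continuous_const_smul g.1).comp continuous_fst).prodMk
      ((continuous_const_smul g.2).comp continuous_snd)
  · simp only [Prod.map, Prod.mk.injEq, hf.apply_eq_iff_mem_orbit, hf'.apply_eq_iff_mem_orbit]
    constructor
    · rintro ⟨⟨g, hg⟩, h, hh⟩
      exact ⟨(g, h), Prod.ext hg hh⟩
    · rintro ⟨g, hg⟩
      exact ⟨⟨g.1, congrArg Prod.fst hg⟩, g.2, congrArg Prod.snd hg⟩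
  · obtain ⟨U, hU, hU'⟩ := hf.disjoint p.1
    obtain ⟨W, hW, hW'⟩ := hf'.disjoint p.2
    refine ⟨U ×ˢ W, prod_mem_nhds hU hW, ?_⟩
    rintro g ⟨_, ⟨q, hq, rfl⟩, hq'⟩
    exact Prod.ext (hU' g.1 ⟨_, ⟨q.1, hq.1, rfl⟩, hq'.1⟩) (hW' g.2 ⟨_, ⟨q.2, hq.2, rfl⟩, hq'.2⟩)

/-! ### The polyhedron of a presentation with stable pairs -/

/-- Under the stable pairs condition, the letter `y²` of a word depends on its letter `y¹` only,
and determines it. -/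
theorem StablePairs.snd_eq_iff {n r : ℕ} {β : Fin n × Fin r ≃ Fin n × Fin r}
    (hβ : ∀ e, (β e).1 = e.1) (hP : StablePairs (Set.range (presentation β)))
    (e e' : Fin n × Fin r) : (β e).2 = (β e').2 ↔ e.2 = e'.2 := by
  have hw : presentation β e = word e.1 e.2 e.1 (β e).2 := by
    rw [presentation, hβ]
  -- The condition is read at the word of `e` itself, which belongs to the presentation.
  have h := ((hP e.1 e.2 (β e).2).1 ⟨e, hw⟩).2 (presentation β e') ⟨e', rfl⟩
  constructor
  · intro he
    obtain ⟨p, hp⟩ := h (.inr ⟨3, by simp [presentation, word, he]⟩)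
    have := congrFun hp 1
    simpa [presentation, word, eq_comm] using this
  · intro he
    obtain ⟨p, hp⟩ := h (.inl ⟨1, by simp [presentation, word, he]⟩)
    have := congrFun hp 3
    simpa [presentation, word, eq_comm] using this

section

variable {n r : ℕ} {β : Fin n × Fin r ≃ Fin n × Fin r}

/-- The point of a product of theta graphs that corresponds to a point of a square. -/
def squarePoint (p : Σ _ : Fin n × Fin r, I × I) : Theta n × Theta r :=
  (thetaPoint (p.1.1, p.2.1), thetaPoint (p.1.2, p.2.2))

theorem continuous_squarePoint : Continuous (squarePoint (n := n) (r := r)) :=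
  continuous_sigma fun e =>
    (continuous_thetaPoint.comp (by fun_prop : Continuous fun p : I × I => (e.1, p.1))).prodMk
      (continuous_thetaPoint.comp (by fun_prop : Continuous fun p : I × I => (e.2, p.2)))

theorem squarePoint_surjective : Function.Surjective (squarePoint (n := n) (r := r)) := by
  rintro ⟨p, q⟩
  obtain ⟨⟨m, s⟩, rfl⟩ := thetaPoint_surjective p
  obtain ⟨⟨l, t⟩, rfl⟩ := thetaPoint_surjective q
  exact ⟨⟨(m, l), s, t⟩, rfl⟩

/-- Equal labels force $i=j$. On an $x$-side the second coordinate is an end of its edge, so only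
$m$ matters; on a $y$-side only $l$ matters, and for $y^2$ this uses stable pairs. -/
theorem squarePoint_eq_of_sideRel (hβ : ∀ e, (β e).1 = e.1)
    (hP : StablePairs (Set.range (presentation β))) {p q : Σ _ : Fin n × Fin r, I × I}
    (h : SideRel (presentation β) p q) : squarePoint p = squarePoint q := by
  obtain ⟨e, e', i, j, h, t⟩ := h
  have hy := StablePairs.snd_eq_iff hβ hP e e'
  refine Prod.ext (thetaPoint_eq_iff.2 ?_) (thetaPoint_eq_iff.2 ?_) <;>
    fin_cases i <;> fin_cases j <;> simp_all [presentation, word, side]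

/-- Points on the sides `i` of two squares are identified if the labels agree. -/
theorem mk_side_eq {e e' : Fin n × Fin r} (i : Fin 4)
    (h : presentation β e i = presentation β e' i) (t : I) :
    (Quot.mk _ ⟨e, side i t⟩ : Polyhedron (presentation β)) = Quot.mk _ ⟨e', side i t⟩ :=
  Quot.sound (SideRel.glue e e' i i h t)

theorem mk_eq_mk_of_fst (hβ : ∀ e, (β e).1 = e.1) {e e' : Fin n × Fin r} (h : e.1 = e'.1)
    {t : I} (ht : t = 0 ∨ t = 1) (s : I) :
    (Quot.mk _ ⟨e, s, t⟩ : Polyhedron (presentation β)) = Quot.mk _ ⟨e', s, t⟩ := by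
  rcases ht with rfl | rfl
  · exact mk_side_eq 0 (by simp [presentation, word, h]) s
  · simpa [side] using mk_side_eq (β := β) (e := e) (e' := e') 2
      (by simp [presentation, word, h, hβ]) (σ s)

theorem mk_eq_mk_of_snd (hβ : ∀ e, (β e).1 = e.1)
    (hP : StablePairs (Set.range (presentation β))) {e e' : Fin n × Fin r} (h : e.2 = e'.2)
    {s : I} (hs : s = 0 ∨ s = 1) (t : I) :
    (Quot.mk _ ⟨e, s, t⟩ : Polyhedron (presentation β)) = Quot.mk _ ⟨e', s, t⟩ := by
  rcases hs with rfl | rfl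
  · simpa [side] using mk_side_eq (β := β) (e := e) (e' := e') 3
      (by simp [presentation, word, (StablePairs.snd_eq_iff hβ hP e e').2 h]) (σ t)
  · exact mk_side_eq 1 (by simp [presentation, word, h]) t

theorem mk_eq_mk_of_squarePoint_eq (hβ : ∀ e, (β e).1 = e.1)
    (hP : StablePairs (Set.range (presentation β))) {p q : Σ _ : Fin n × Fin r, I × I}
    (h : squarePoint p = squarePoint q) :
    (Quot.mk _ p : Polyhedron (presentation β)) = Quot.mk _ q := by
  obtain ⟨⟨m, l⟩, s, t⟩ := p
  obtain ⟨⟨m', l'⟩, s', t'⟩ := q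
  obtain ⟨rfl : s = s', hm⟩ := thetaPoint_eq_iff.1 (Prod.ext_iff.1 h).1
  obtain ⟨rfl : t = t', hl⟩ := thetaPoint_eq_iff.1 (Prod.ext_iff.1 h).2
  simp only at hm hl
  -- The intermediate square exists because the bipartite graph is complete.
  trans Quot.mk _ ⟨(m', l), s, t⟩
  · rcases hm with rfl | hs
    · rfl
    · exact mk_eq_mk_of_snd (e := (m, l)) (e' := (m', l)) hβ hP rfl hs t
  · rcases hl with rfl | ht
    · rfl
    · exact mk_eq_mk_of_fst (e := (m', l)) (e' := (m', l')) hβ rfl ht s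

/-- The polyhedron of a presentation with stable pairs is a product of theta graphs. -/
theorem nonempty_homeomorph_polyhedron (hβ : ∀ e, (β e).1 = e.1)
    (hP : StablePairs (Set.range (presentation β))) :
    Nonempty (Theta n × Theta r ≃ₜ Polyhedron (presentation β)) := by
  let f : Polyhedron (presentation β) → Theta n × Theta r :=
    Quot.lift squarePoint fun _ _ => squarePoint_eq_of_sideRel hβ hP
  have hf : Continuous f := continuous_quot_lift _ continuous_squarePoint
  have hbij : Function.Bijective f := by
    constructor
    · intro p q h
      obtain ⟨p, rfl⟩ := Quot.exists_rep p
      obtain ⟨q, rfl⟩ := Quot.exists_rep q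
      exact mk_eq_mk_of_squarePoint_eq hβ hP h
    · intro y
      obtain ⟨p, rfl⟩ := squarePoint_surjective y
      exact ⟨Quot.mk _ p, rfl⟩
  have : CompactSpace (Polyhedron (presentation β)) :=
    inferInstanceAs (CompactSpace (Quot (SideRel (presentation β))))
  -- A continuous bijection from a compact to a Hausdorff space is a homeomorphism.
  exact ⟨(Continuous.homeoOfEquivCompactToT2 (f := Equiv.ofBijective f hbij) hf).symm⟩

end

end BMType

theorem lemma5p4 (n r : ℕ) (hn : 1 ≤ n) (hr : 1 ≤ r)
    (β : Fin n × Fin r ≃ Fin n × Fin r) (hβ : ∀ e, (β e).1 = e.1)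
    (hP : BMType.StablePairs (Set.range (BMType.presentation β)))
    (x : BMType.Polyhedron (BMType.presentation β)) :
    BMType.IsOfBMType (2 * (n - 1)) (2 * (r - 1))
      (FundamentalGroup (BMType.Polyhedron (BMType.presentation β)) x) := by
  obtain ⟨a, rfl⟩ := Nat.exists_eq_add_of_le' hn
  obtain ⟨b, rfl⟩ := Nat.exists_eq_add_of_le' hr
  obtain ⟨φ⟩ := BMType.nonempty_homeomorph_polyhedron hβ hP
  let _ := BMType.prodMulAction (FreeGroup (Fin a)) (FreeGroup (Fin b))
    (BMType.ThetaTree a) (BMType.ThetaTree b)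
  have hcov := (BMType.isQuotientCoveringMap_prodMap
    (BMType.isQuotientCoveringMap_thetaCover (k := a))
    (BMType.isQuotientCoveringMap_thetaCover (k := b))).homeomorph_comp φ
  obtain ⟨e, he⟩ := hcov.surjective x
  -- The covering space is contractible, so $\pi_1$ is the opposite of the acting group; inversion
  -- identifies that with the group.
  exact BMType.isOfBMType_of_mulEquiv
    ((hcov.fundamentalGroupEquiv ⟨e, he⟩).trans (MulEquiv.inv' _).symm)
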